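/- Let $M\in\mathbb{N}$, let $(x_m,y_m)\in\mathbb{R}^2$, $1\le m\le M$, be data points with $x_1<\dots<x_M$, let $E:\mathbb{R}\times\mathbb{R}\to\mathbb{R}$ be such that $E(\cdot,y)$ is strictly convex and coercive for every $y$, and let $\lambda>0$, $\bar L>0$. For $f:\mathbb{R}\to\mathbb{R}$ put $L(f)=\sup_{s\ne t}\frac{|f(s)-f(t)|}{|s-t|}$ and ${\rm TV}^{(2)}(f)=\sup\{\int_{\mathbb{R}} f\varphi'' : \varphi\in C_c^\infty(\mathbb{R}),\ \|\varphi\|_\infty=1\}$, and let ${\rm BV}^{(2)}(\mathbb{R})$ be the space of functions (identified with their continuous representatives) with ${\rm TV}^{(2)}(f)<\infty$. Consider the problem $$(\mathrm{P})\qquad \min_{f\in{\rm BV}^{(2)}(\mathbb{R})}\ \sum_{m=1}^M E(f(x_m),y_m)+\lambda\,{\rm TV}^{(2)}(f)\quad\text{s.t. } L(f)\le\bar L .$$ For a parameter vector $\theta=(K,\mathbf v,\mathbf w,\mathbf b,\mathbf c)$ with $K\in\mathbb{N}$ (also variable), $\mathbf v,\mathbf w,\mathbf b\in\mathbb{R}^K$,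 $\mathbf c=(c_0,c_1)\in\mathbb{R}^2$, let $f_\theta(x)=c_0+c_1x+\sum_{k=1}^K v_k\max(w_kx-b_k,0)$, and consider the training problem $$(\mathrm{NN})\qquad \min_{\theta}\ \sum_{m=1}^M E(f_\theta(x_m),y_m)+\lambda\sum_{k=1}^K\frac{|v_k|^2+|w_k|^2}{2}\quad\text{s.t. } L(f_\theta)\le\bar L .$$ A function is CPWL if it is continuous and piecewise linear with finitely many knots in each bounded interval. Then: 1. If $\theta^*$ is a solution of $(\mathrm{NN})$, then $f_{\theta^*}$ is a solution of $(\mathrm{P})$ and is CPWL with finitely many linear regions; moreover $|v_k^*|=|w_k^*|$ for all $k=1,\dots,K^*$. 2. For every CPWL solution $f$ of $(\mathrm{P})$ there is a solution $\theta^*$ of $(\mathrm{NN})$ with $f=f_{\theta^*}$. -/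

import Mathlib

open Filter Set MeasureTheory
open scoped ENNReal ContDiff

namespace LipReLU

noncomputable section

/-- Test functions `φ ∈ 𝓓(ℝ)` (smooth, compactly supported) whose supremum norm equals `1`.
For a continuous function the supremum norm is the `L_∞` norm. -/
def IsUnitTestFunction (φ : ℝ → ℝ) : Prop :=
  ContDiff ℝ ∞ φ ∧ HasCompactSupport φ ∧ (⨆ x : ℝ, |φ x|) = 1

/-- The second-order total variation `TV⁽²⁾(f) = sup ∫ f φ''` over the test functions `φ` with
`‖φ‖_∞ = 1`, as an element of `[0, ∞]`. (The admissible `φ` are stable under `φ ↦ -φ`, so cutting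
the integrals off at `0` does not change the supremum.) -/
def TV2 (f : ℝ → ℝ) : ℝ≥0∞ :=
  ⨆ (φ : ℝ → ℝ) (_ : IsUnitTestFunction φ), ENNReal.ofReal (∫ x, f x * iteratedDeriv 2 φ x)

/-- `BV⁽²⁾(ℝ)`: the functions with finite second-order total variation. Every distribution with
finite second-order total variation is represented by exactly one continuous function, and point
values of an element of `BV⁽²⁾(ℝ)` are those of this representative. -/
def BV2 : Set (ℝ → ℝ) := {f | Continuous f ∧ TV2 f < ⊤}

/-- The Lipschitz constant `L(f) = sup_{x₁ ≠ x₂} |f x₁ - f x₂| / |x₁ - x₂|`, in `[0, ∞]`. -/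
def lipConst (f : ℝ → ℝ) : ℝ≥0∞ :=
  ⨆ (x₁ : ℝ) (x₂ : ℝ) (_ : x₁ ≠ x₂), ENNReal.ofReal (|f x₁ - f x₂| / |x₁ - x₂|)

/-- `f` is continuous, and affine on every open interval that contains no point of `S`. -/
def IsCPWLWithKnots (f : ℝ → ℝ) (S : Set ℝ) : Prop :=
  Continuous f ∧ ∀ a b : ℝ, a < b → Disjoint (Ioo a b) S →
    ∃ p q : ℝ, ∀ t ∈ Ioo a b, f t = p * t + q

/-- Continuous piecewise-linear functions on `ℝ`: the knots form a locally finite set (finitely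
many in every bounded interval; infinitely many knots in total are allowed). -/
def IsCPWL (f : ℝ → ℝ) : Prop :=
  ∃ S : Set ℝ, (∀ a b : ℝ, (S ∩ Icc a b).Finite) ∧ IsCPWLWithKnots f S

/-- CPWL functions with finitely many linear regions. -/
def IsFiniteCPWL (f : ℝ → ℝ) : Prop :=
  ∃ S : Set ℝ, S.Finite ∧ IsCPWLWithKnots f S

/-- The solution set of the problem: minimize `∑ₘ E (f xₘ) yₘ + lam * TV⁽²⁾(f)` over
`f ∈ BV⁽²⁾(ℝ)` subject to `L(f) ≤ Lbar`. On `BV⁽²⁾(ℝ)` the value `TV⁽²⁾(f)` is finite. -/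
def Vhyb {M : ℕ} (E : ℝ → ℝ → ℝ) (x y : Fin M → ℝ) (lam Lbar : ℝ) : Set (ℝ → ℝ) :=
  {f | (f ∈ BV2 ∧ lipConst f ≤ ENNReal.ofReal Lbar) ∧
    ∀ g : ℝ → ℝ, g ∈ BV2 → lipConst g ≤ ENNReal.ofReal Lbar →
      ∑ m, E (f (x m)) (y m) + lam * (TV2 f).toReal ≤
        ∑ m, E (g (x m)) (y m) + lam * (TV2 g).toReal}

/-- Parameter vectors `θ = (K, v, w, b, c)` of two-layer univariate ReLU networks with a skip
connection. The width `K` is a part of the parameter vector. -/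
structure Params where
  /-- width -/
  K : ℕ
  /-- weights of the second layer -/
  v : Fin K → ℝ
  /-- weights of the first layer -/
  w : Fin K → ℝ
  /-- biases of the first layer -/
  b : Fin K → ℝ
  /-- bias of the second layer -/
  c₀ : ℝ
  /-- weight of the skip connection -/
  c₁ : ℝ

/-- The rectified linear unit. -/
def relu (t : ℝ) : ℝ := max t 0

/-- The network `f_θ(x) = c₀ + c₁ x + ∑ₖ vₖ ReLU(wₖ x - bₖ)`. -/
def Params.net (θ : Params) (t : ℝ) : ℝ :=
  θ.c₀ + θ.c₁ * t + ∑ k, θ.v k * relu (θ.w k * t - θ.b k)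

/-- The weight-decay term `R(θ) = ∑ₖ (|vₖ|² + |wₖ|²) / 2`. -/
def Params.weightDecay (θ : Params) : ℝ :=
  ∑ k, (|θ.v k| ^ 2 + |θ.w k| ^ 2) / 2

/-- The solution set of the training problem: minimize `∑ₘ E (f_θ xₘ) yₘ + lam * R(θ)` over all
parameter vectors `θ` (of all widths) subject to `L(f_θ) ≤ Lbar`. -/
def VNN {M : ℕ} (E : ℝ → ℝ → ℝ) (x y : Fin M → ℝ) (lam Lbar : ℝ) : Set Params :=
  {θ | lipConst θ.net ≤ ENNReal.ofReal Lbar ∧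
    ∀ η : Params, lipConst η.net ≤ ENNReal.ofReal Lbar →
      ∑ m, E (θ.net (x m)) (y m) + lam * θ.weightDecay ≤
        ∑ m, E (η.net (x m)) (y m) + lam * η.weightDecay}

end

end LipReLU

/-!
For knots `q 0 < q 1 < …` and bounded coefficients `|ε i| ≤ 1`, the sum of `ε i` times the hat
function at `q (i + 1)` is bounded by one, and its second derivative integrates `f` to the sum of
`ε i` times the slope jumps of the broken line interpolating `f`. After mollification it is a test
function, and hence the total variation of the slope of the broken line is at most `TV⁽²⁾(f)`.
A network whose units carry weights of equal modulus realizes the broken line with weight decay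
equal to this total variation. Conversely `TV⁽²⁾(f_θ) ≤ ∑ₖ |vₖ| |wₖ|`, which by AM-GM is at most
the weight decay, with equality only if `|vₖ| = |wₖ|` for all `k`. As interpolation at the data
points changes neither the data term nor the constraint, the two problems have the same value.
A CPWL solution of the variational problem agrees with a broken line on an interval around the
data, and a slope change outside would make its `TV⁽²⁾` exceed that of this broken line, which is
thus the solution itself.
-/

namespace LipReLU

open scoped NNReal Convolution Topology

lemma relu_of_nonneg {t : ℝ} (h : 0 ≤ t) : relu t = t := max_eq_left h

lemma relu_of_nonpos {t : ℝ} (h : t ≤ 0) : relu t = 0 := max_eq_right h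

lemma relu_mul {a : ℝ} (ha : 0 ≤ a) (t : ℝ) : relu (a * t) = a * relu t := by
  rw [relu, relu, mul_max_of_nonneg _ _ ha, mul_zero]

lemma relu_neg (t : ℝ) : relu (-t) = relu t - t := by
  rcases le_total 0 t with h | h
  · rw [relu_of_nonneg h, relu_of_nonpos (neg_nonpos.2 h), sub_self]
  · rw [relu_of_nonpos h, relu_of_nonneg (neg_nonneg.2 h), zero_sub]

@[fun_prop]
lemma continuous_relu : Continuous relu := continuous_id.max continuous_const

lemma monotone_relu : Monotone relu := monotone_id.max monotone_const

lemma lipschitzWith_one_relu : LipschitzWith 1 relu := LipschitzWith.id.max_const 0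

lemma convexOn_relu_sub (t : ℝ) : ConvexOn ℝ univ fun s => relu (t - s) :=
  ((convexOn_const t convex_univ).sub (concaveOn_id convex_univ)).sup
    (convexOn_const 0 convex_univ)

lemma exists_relu_mul_sub_eq (w b : ℝ) : ∃ p r : ℝ, ∀ t,
    relu (w * t - b) = |w| * relu (t - b / w) + (p * t + r) := by
  rcases eq_or_ne w 0 with rfl | hw
  · exact ⟨0, relu (-b), fun t => by simp⟩
  have hfactor (t : ℝ) : w * t - b = w * (t - b / w) := by field_simp
  rcases hw.lt_or_gt with hneg | hpos
  · refine ⟨w, -b, fun t => ?_⟩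
    rw [hfactor, ← neg_mul_neg, relu_mul (neg_nonneg.2 hneg.le), relu_neg, abs_of_neg hneg]
    linear_combination -div_mul_cancel₀ b hw
  · exact ⟨0, 0, fun t => by rw [hfactor, relu_mul hpos.le, abs_of_pos hpos]; ring⟩

section Lipschitz

variable {f : ℝ → ℝ} {K : ℝ≥0}

lemma lipConst_le_iff_lipschitzWith :
    lipConst f ≤ ENNReal.ofReal K ↔ LipschitzWith K f := by
  simp only [lipConst, iSup_le_iff, lipschitzWith_iff_dist_le_mul, Real.dist_eq]
  refine forall₂_congr fun s t => ?_
  rcases eq_or_ne s t with rfl | hst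
  · simp
  · simp only [hst, ne_eq, not_false_eq_true, forall_true_left,
      ENNReal.ofReal_le_ofReal_iff K.coe_nonneg, div_le_iff₀ (abs_pos.2 (sub_ne_zero.2 hst))]

lemma abs_slope_le_of_lipschitzWith (hf : LipschitzWith K f) {a b : ℝ} (hab : a ≠ b) :
    |slope f a b| ≤ K := by
  rw [slope_def_field, abs_div, div_le_iff₀ (abs_pos.2 (sub_ne_zero.2 hab.symm))]
  exact hf.dist_le_mul b a

lemma lipschitzWith_add_mul_sub {m : ℝ} (hm : |m| ≤ K) (a b : ℝ) :
    LipschitzWith K fun t => a + m * (t - b) := by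
  refine LipschitzWith.of_dist_le_mul fun s t => ?_
  rw [Real.dist_eq, Real.dist_eq, show a + m * (s - b) - (a + m * (t - b)) = m * (s - t) by ring,
    abs_mul]
  exact mul_le_mul_of_nonneg_right hm (abs_nonneg _)

lemma lipschitzWith_of_Iic_of_Ici {c : ℝ} (hle : LipschitzOnWith K f (Iic c))
    (hge : LipschitzOnWith K f (Ici c)) : LipschitzWith K f := by
  refine LipschitzWith.of_dist_le_mul fun s t => ?_
  wlog hst : s ≤ t generalizing s t
  · rw [dist_comm (f s), dist_comm s]
    exact this t s (le_of_not_ge hst)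
  rcases le_total t c with htc | hct
  · exact hle.dist_le_mul s (hst.trans htc) t htc
  rcases le_total c s with hcs | hsc
  · exact hge.dist_le_mul s hcs t (hcs.trans hst)
  calc dist (f s) (f t) ≤ dist (f s) (f c) + dist (f c) (f t) := dist_triangle _ _ _
    _ ≤ K * dist s c + K * dist c t :=
        add_le_add (hle.dist_le_mul s hsc c self_mem_Iic) (hge.dist_le_mul c self_mem_Ici t hct)
    _ = K * dist s t := by
        rw [Real.dist_eq, Real.dist_eq, Real.dist_eq, abs_of_nonpos (sub_nonpos.2 hsc),
          abs_of_nonpos (sub_nonpos.2 hct), abs_of_nonpos (sub_nonpos.2 hst)]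
        ring

end Lipschitz

/-! ### Broken lines -/

/-- The change at `q (i + 1)` of the slope of the broken line interpolating `f` at the knots
`q 0 < q 1 < …`. -/
noncomputable def slopeJump (q : ℕ → ℝ) (f : ℝ → ℝ) (i : ℕ) : ℝ :=
  slope f (q (i + 1)) (q (i + 2)) - slope f (q i) (q (i + 1))

/-- The broken line interpolating `f` at `q 0, …, q (n + 1)`, extended affinely to both sides. -/
noncomputable def brokenLine (q : ℕ → ℝ) (f : ℝ → ℝ) (n : ℕ) (t : ℝ) : ℝ :=
  f (q 0) + slope f (q 0) (q 1) * (t - q 0) +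
    ∑ i ∈ Finset.range n, slopeJump q f i * relu (t - q (i + 1))

/-- The total variation of the slope of `brokenLine q f n`. -/
noncomputable def slopeVar (q : ℕ → ℝ) (f : ℝ → ℝ) (n : ℕ) : ℝ :=
  ∑ i ∈ Finset.range n, |slopeJump q f i|

section BrokenLine

variable {q : ℕ → ℝ} {f : ℝ → ℝ} {k n : ℕ} {t : ℝ}

lemma slope_mul_sub (f : ℝ → ℝ) (a b : ℝ) : slope f a b * (b - a) = f b - f a := by
  rw [mul_comm, ← smul_eq_mul, sub_smul_slope, vsub_eq_sub]

lemma brokenLine_zero : brokenLine q f 0 t = f (q 0) + slope f (q 0) (q 1) * (t - q 0) := by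
  simp [brokenLine]

lemma brokenLine_succ :
    brokenLine q f (n + 1) t = brokenLine q f n t + slopeJump q f n * relu (t - q (n + 1)) := by
  simp [brokenLine, Finset.sum_range_succ, add_assoc]

lemma brokenLine_succ_of_le (ht : t ≤ q (n + 1)) :
    brokenLine q f (n + 1) t = brokenLine q f n t := by
  rw [brokenLine_succ, relu_of_nonpos (sub_nonpos.2 ht), mul_zero, add_zero]

lemma brokenLine_of_le (hq : StrictMono q) (hkn : k ≤ n) (ht : t ≤ q (k + 1)) :
    brokenLine q f n t = brokenLine q f k t := by
  induction n, hkn using Nat.le_induction with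
  | base => rfl
  | succ n hkn ih => rw [brokenLine_succ_of_le (ht.trans (hq.monotone (by omega))), ih]

lemma brokenLine_of_ge (hq : StrictMono q) (ht : q n ≤ t) :
    brokenLine q f n t = f (q n) + slope f (q n) (q (n + 1)) * (t - q n) := by
  induction n with
  | zero => exact brokenLine_zero
  | succ n ih =>
    have hlt : q n < q (n + 1) := hq n.lt_succ_self
    rw [brokenLine_succ, relu_of_nonneg (sub_nonneg.2 ht), ih (hlt.le.trans ht), slopeJump]
    linear_combination slope_mul_sub f (q n) (q (n + 1))

lemma brokenLine_of_mem_Icc (hq : StrictMono q) (hkn : k ≤ n) (ht : t ∈ Icc (q k) (q (k + 1))) :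
    brokenLine q f n t = f (q k) + slope f (q k) (q (k + 1)) * (t - q k) := by
  rw [brokenLine_of_le hq hkn ht.2, brokenLine_of_ge hq ht.1]

lemma brokenLine_knot (hq : StrictMono q) (hkn : k ≤ n + 1) :
    brokenLine q f n (q k) = f (q k) := by
  rcases hkn.lt_or_eq with hlt | rfl
  · rw [brokenLine_of_mem_Icc hq (Nat.lt_succ_iff.1 hlt) (left_mem_Icc.2 (hq k.lt_succ_self).le)]
    ring
  · have hlt : q n < q (n + 1) := hq n.lt_succ_self
    rw [brokenLine_of_ge hq hlt.le]
    linear_combination slope_mul_sub f (q n) (q (n + 1))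

lemma lipschitzWith_brokenLine (hq : StrictMono q) {K : ℝ≥0} (hf : LipschitzWith K f) (n : ℕ) :
    LipschitzWith K (brokenLine q f n) := by
  have hslope (i : ℕ) : |slope f (q i) (q (i + 1))| ≤ K :=
    abs_slope_le_of_lipschitzWith hf (hq i.lt_succ_self).ne
  induction n with
  | zero =>
    rw [show brokenLine q f 0 = _ from funext fun t => brokenLine_zero]
    exact lipschitzWith_add_mul_sub (hslope 0) _ _
  | succ n ih =>
    refine lipschitzWith_of_Iic_of_Ici (c := q (n + 1)) (fun s hs t ht => ?_) fun s hs t ht => ?_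
    · rw [brokenLine_succ_of_le hs, brokenLine_succ_of_le ht]
      exact ih s t
    · rw [brokenLine_of_ge hq hs, brokenLine_of_ge hq ht]
      exact lipschitzWith_add_mul_sub (hslope (n + 1)) _ _ s t

lemma exists_mem_Icc_knots (ht : t ∈ Icc (q 0) (q (n + 1))) :
    ∃ i ≤ n, t ∈ Icc (q i) (q (i + 1)) := by
  induction n with
  | zero => exact ⟨0, le_rfl, ht⟩
  | succ n ih =>
    rcases le_total t (q (n + 1)) with hle | hge
    · obtain ⟨i, hi, hti⟩ := ih ⟨ht.1, hle⟩
      exact ⟨i, by omega, hti⟩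
    · exact ⟨n + 1, le_rfl, hge, ht.2⟩

lemma eqOn_brokenLine_of_affine (hq : StrictMono q) (hf : Continuous f)
    (haff : ∀ i ≤ n, ∃ p r : ℝ, ∀ t ∈ Ioo (q i) (q (i + 1)), f t = p * t + r) :
    EqOn (brokenLine q f n) f (Icc (q 0) (q (n + 1))) := by
  intro t ht
  obtain ⟨i, hi, hti⟩ := exists_mem_Icc_knots ht
  obtain ⟨p, r, hpr⟩ := haff i hi
  have hlt : q i < q (i + 1) := hq i.lt_succ_self
  have hclosed : EqOn f (fun s => p * s + r) (Icc (q i) (q (i + 1))) := by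
    rw [← closure_Ioo hlt.ne]
    exact EqOn.closure hpr hf (by fun_prop)
  have hslope : slope f (q i) (q (i + 1)) = p := by
    rw [slope_def_field, div_eq_iff (sub_ne_zero.2 hlt.ne'), hclosed (left_mem_Icc.2 hlt.le),
      hclosed (right_mem_Icc.2 hlt.le)]
    ring
  rw [brokenLine_of_mem_Icc hq hi hti, hslope, hclosed hti, hclosed (left_mem_Icc.2 hlt.le)]
  ring

end BrokenLine

section Knots

variable {q : ℕ → ℝ} {t : ℝ}

/-- The sequence `q` with the term `t` put in front of it. -/
def prepend (t : ℝ) (q : ℕ → ℝ) : ℕ → ℝ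
  | 0 => t
  | i + 1 => q i

lemma strictMono_prepend (hq : StrictMono q) (ht : t < q 0) : StrictMono (prepend t q) :=
  strictMono_nat_of_lt_succ fun
    | 0 => ht
    | i + 1 => hq i.lt_succ_self

lemma exists_strictMono_eqOn_Iio (hq : StrictMono q) {n : ℕ} (ht : ∀ i < n, q i < t) :
    ∃ q' : ℕ → ℝ, StrictMono q' ∧ EqOn q' q (Iio n) ∧ q' n = t := by
  refine ⟨fun i => if i < n then q i else t + ((i : ℝ) - n), ?_, fun i hi => if_pos hi, by simp⟩
  refine strictMono_nat_of_lt_succ fun i => ?_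
  split_ifs with hi hi' hi'
  · exact hq i.lt_succ_self
  · obtain rfl : n = i + 1 := by omega
    simpa using ht i hi
  · omega
  · push_cast
    linarith

lemma exists_strictMono_image_Iio_eq (P : Finset ℝ) :
    ∃ q : ℕ → ℝ, StrictMono q ∧ q '' Iio P.card = P := by
  induction P using Finset.induction_on_max with
  | empty => exact ⟨fun n => n, Nat.strictMono_cast, by simp⟩
  | insert a P ha ih =>
    obtain ⟨q, hq, hqP⟩ := ih
    obtain ⟨q', hq', heq, hqa⟩ := exists_strictMono_eqOn_Iio hq (t := a) (n := P.card)
      fun i hi => ha _ (Finset.mem_coe.1 (hqP ▸ mem_image_of_mem q hi))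
    refine ⟨q', hq', ?_⟩
    rw [Finset.card_insert_of_notMem fun h => (ha a h).false, ← Order.succ_eq_add_one,
      Order.Iio_succ_eq_insert, image_insert_eq, heq.image_eq, hqP, hqa,
      Finset.coe_insert]

end Knots

/-- `brokenLine q f n` as a network, with equal moduli of the two weights of every unit. -/
noncomputable def brokenLineParams (q : ℕ → ℝ) (f : ℝ → ℝ) (n : ℕ) : Params where
  K := n
  v i := SignType.sign (slopeJump q f i) * √|slopeJump q f i|
  w i := √|slopeJump q f i|
  b i := √|slopeJump q f i| * q (i + 1)
  c₀ := f (q 0) - slope f (q 0) (q 1) * q 0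
  c₁ := slope f (q 0) (q 1)

lemma brokenLineParams_net (q : ℕ → ℝ) (f : ℝ → ℝ) (n : ℕ) :
    (brokenLineParams q f n).net = brokenLine q f n := by
  funext t
  simp only [Params.net, brokenLineParams, brokenLine, Finset.sum_range]
  congr 1
  · ring
  · refine Finset.sum_congr rfl fun i _ => ?_
    rw [← mul_sub, relu_mul (Real.sqrt_nonneg _), mul_assoc, ← mul_assoc (√_),
      Real.mul_self_sqrt (abs_nonneg _), ← mul_assoc, sign_mul_abs]

lemma brokenLineParams_weightDecay (q : ℕ → ℝ) (f : ℝ → ℝ) (n : ℕ) :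
    (brokenLineParams q f n).weightDecay = slopeVar q f n := by
  simp only [Params.weightDecay, brokenLineParams, slopeVar, Finset.sum_range]
  refine Finset.sum_congr rfl fun i _ => ?_
  rw [sq_abs, sq_abs, mul_pow, Real.sq_sqrt (abs_nonneg _)]
  rcases lt_trichotomy (slopeJump q f i) 0 with h | h | h <;> simp [h]

/-! ### Splines and their second derivatives -/

/-- The linear spline which vanishes near `-∞` and has as second derivative the discrete measure
with mass `c a` at `a`. Finitely supported functions serve as discrete measures throughout, so
`Finsupp.linearCombination ℝ g c` is the integral of `g` with respect to `c`. -/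
noncomputable def spline (c : ℝ →₀ ℝ) (t : ℝ) : ℝ :=
  Finsupp.linearCombination ℝ (fun a => relu (t - a)) c

/-- The second derivative of a network as a discrete measure. A unit with `w k = 0` has the junk
knot `b k / 0 = 0`, but mass zero. -/
noncomputable def Params.curvature (θ : Params) : ℝ →₀ ℝ :=
  ∑ k, Finsupp.single (θ.b k / θ.w k) (θ.v k * |θ.w k|)

lemma spline_apply (c : ℝ →₀ ℝ) (t : ℝ) :
    spline c t = ∑ a ∈ c.support, c a * relu (t - a) := rfl

lemma continuous_spline (c : ℝ →₀ ℝ) : Continuous (spline c) := by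
  simp only [funext (spline_apply c)]
  fun_prop

lemma Params.linearCombination_curvature (θ : Params) (g : ℝ → ℝ) :
    Finsupp.linearCombination ℝ g θ.curvature =
      ∑ k, θ.v k * |θ.w k| * g (θ.b k / θ.w k) := by
  simp only [Params.curvature, map_sum, Finsupp.linearCombination_single, smul_eq_mul]

lemma Params.exists_net_eq_spline (θ : Params) :
    ∃ p r : ℝ, ∀ t, θ.net t = p * t + r + spline θ.curvature t := by
  choose p r hpr using fun k => exists_relu_mul_sub_eq (θ.w k) (θ.b k)
  refine ⟨θ.c₁ + ∑ k, θ.v k * p k, θ.c₀ + ∑ k, θ.v k * r k, fun t => ?_⟩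
  simp only [Params.net, hpr, spline, θ.linearCombination_curvature, mul_add,
    Finset.sum_add_distrib, add_mul, Finset.sum_mul, ← mul_assoc]
  ring

lemma Params.continuous_net (θ : Params) : Continuous θ.net := by
  unfold Params.net
  fun_prop

lemma exists_relu_sub_eq_of_notMem_Ioo {a l u : ℝ} (ha : a ∉ Ioo l u) :
    ∃ p r : ℝ, ∀ t ∈ Ioo l u, relu (t - a) = p * t + r := by
  rcases le_or_gt a l with hal | hla
  · exact ⟨1, -a, fun t ht => by rw [relu_of_nonneg (by linarith [ht.1])]; ring⟩
  · have hua : u ≤ a := not_lt.1 fun hau => ha ⟨hla, hau⟩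
    exact ⟨0, 0, fun t ht => by rw [relu_of_nonpos (by linarith [ht.2])]; ring⟩

lemma isCPWLWithKnots_spline (c : ℝ →₀ ℝ) : IsCPWLWithKnots (spline c) c.support := by
  refine ⟨continuous_spline c, fun l u _ hdisj => ?_⟩
  choose! p r hpr using fun a (ha : a ∈ c.support) =>
    exists_relu_sub_eq_of_notMem_Ioo (disjoint_right.1 hdisj (Finset.mem_coe.2 ha))
  refine ⟨∑ a ∈ c.support, c a * p a, ∑ a ∈ c.support, c a * r a, fun t ht => ?_⟩
  rw [spline_apply, Finset.sum_mul, ← Finset.sum_add_distrib]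
  exact Finset.sum_congr rfl fun a ha => by rw [hpr a ha t ht]; ring

lemma Params.isFiniteCPWL_net (θ : Params) : IsFiniteCPWL θ.net := by
  refine ⟨_, θ.curvature.support.finite_toSet, θ.continuous_net, fun l u hlu hdisj => ?_⟩
  obtain ⟨p, r, hnet⟩ := θ.exists_net_eq_spline
  obtain ⟨p', r', hspline⟩ := (isCPWLWithKnots_spline θ.curvature).2 l u hlu hdisj
  exact ⟨p + p', r + r', fun t ht => by rw [hnet, hspline t ht]; ring⟩

/-! ### Total variation of networks -/

section TestFunction

variable {φ g : ℝ → ℝ}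

lemma hasDerivAt_affine_mul_deriv_sub (hφ : ContDiff ℝ 2 φ) (p r t : ℝ) :
    HasDerivAt (fun t => (p * t + r) * deriv φ t - p * φ t)
      ((p * t + r) * iteratedDeriv 2 φ t) t := by
  have hφ' : HasDerivAt φ (deriv φ t) t := (hφ.differentiable two_ne_zero t).hasDerivAt
  have hφ'' : HasDerivAt (deriv φ) (iteratedDeriv 2 φ t) t := by
    rw [iteratedDeriv_succ, iteratedDeriv_one]
    exact (hφ.differentiable_deriv_two t).hasDerivAt
  have haff : HasDerivAt (fun t => p * t + r) p t := by
    simpa using ((hasDerivAt_id t).const_mul p).add_const r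
  exact ((haff.fun_mul hφ'').fun_sub (hφ'.const_mul p)).congr_deriv (by ring)

lemma hasCompactSupport_affine_mul_deriv_sub (hc : HasCompactSupport φ) (p r : ℝ) :
    HasCompactSupport fun t => (p * t + r) * deriv φ t - p * φ t :=
  (hc.deriv.mul_left (f := fun t => p * t + r)).sub (hc.mul_left (f := fun _ => p))

lemma integrable_mul_iteratedDeriv_two (hφ : ContDiff ℝ 2 φ) (hc : HasCompactSupport φ)
    (hg : Continuous g) : Integrable fun t => g t * iteratedDeriv 2 φ t := by
  have hc'' : HasCompactSupport (iteratedDeriv 2 φ) := by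
    rw [iteratedDeriv_succ, iteratedDeriv_one]
    exact hc.deriv.deriv
  exact (hg.mul (hφ.continuous_iteratedDeriv 2 le_rfl)).integrable_of_hasCompactSupport
    hc''.mul_left

lemma integral_affine_mul_iteratedDeriv_two (hφ : ContDiff ℝ 2 φ) (hc : HasCompactSupport φ)
    (p r : ℝ) : ∫ t, (p * t + r) * iteratedDeriv 2 φ t = 0 := by
  have hderiv := hasDerivAt_affine_mul_deriv_sub hφ p r
  have hcont : Continuous fun t => (p * t + r) * deriv φ t - p * φ t :=
    continuous_iff_continuousAt.2 fun t => (hderiv t).continuousAt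
  exact integral_eq_zero_of_hasDerivAt_of_integrable hderiv
    (integrable_mul_iteratedDeriv_two hφ hc (by fun_prop))
    (hcont.integrable_of_hasCompactSupport (hasCompactSupport_affine_mul_deriv_sub hc p r))

lemma integral_relu_sub_mul_iteratedDeriv_two (hφ : ContDiff ℝ 2 φ) (hc : HasCompactSupport φ)
    (a : ℝ) : ∫ t, relu (t - a) * iteratedDeriv 2 φ t = φ a := by
  have hvanish (t : ℝ) (ht : t ∉ Ioi a) : relu (t - a) * iteratedDeriv 2 φ t = 0 := by
    rw [relu_of_nonpos (sub_nonpos.2 (not_lt.1 ht)), zero_mul]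
  have haffine (t : ℝ) (ht : t ∈ Ioi a) :
      relu (t - a) * iteratedDeriv 2 φ t = (1 * t + -a) * iteratedDeriv 2 φ t := by
    rw [relu_of_nonneg (sub_nonneg.2 (le_of_lt ht)), one_mul, sub_eq_add_neg]
  have hlim : Tendsto (fun t => (1 * t + -a) * deriv φ t - 1 * φ t) atTop (𝓝 0) :=
    (hasCompactSupport_affine_mul_deriv_sub hc 1 (-a)).is_zero_at_infty.mono_left
      atTop_le_cocompact
  rw [← setIntegral_eq_integral_of_forall_compl_eq_zero hvanish,
    setIntegral_congr_fun measurableSet_Ioi haffine,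
    integral_Ioi_of_hasDerivAt_of_tendsto' (fun t _ => hasDerivAt_affine_mul_deriv_sub hφ 1 (-a) t)
      (integrable_mul_iteratedDeriv_two hφ hc (by fun_prop)).integrableOn hlim]
  ring

lemma integral_spline_mul_iteratedDeriv_two (hφ : ContDiff ℝ 2 φ) (hc : HasCompactSupport φ)
    (c : ℝ →₀ ℝ) :
    ∫ t, spline c t * iteratedDeriv 2 φ t = Finsupp.linearCombination ℝ φ c := by
  simp only [spline_apply, Finset.sum_mul, mul_assoc]
  rw [integral_finsetSum _ fun a _ =>
    (integrable_mul_iteratedDeriv_two hφ hc (by fun_prop)).const_mul (c a)]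
  simp only [integral_const_mul, integral_relu_sub_mul_iteratedDeriv_two hφ hc,
    Finsupp.linearCombination_apply, Finsupp.sum, smul_eq_mul]

lemma Params.integral_net_mul_iteratedDeriv_two (hφ : ContDiff ℝ 2 φ) (hc : HasCompactSupport φ)
    (θ : Params) :
    ∫ t, θ.net t * iteratedDeriv 2 φ t = Finsupp.linearCombination ℝ φ θ.curvature := by
  obtain ⟨p, r, hnet⟩ := θ.exists_net_eq_spline
  simp only [hnet, add_mul (p * _ + r)]
  rw [integral_add (integrable_mul_iteratedDeriv_two hφ hc (by fun_prop))
      (integrable_mul_iteratedDeriv_two hφ hc (continuous_spline _)),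
    integral_affine_mul_iteratedDeriv_two hφ hc, integral_spline_mul_iteratedDeriv_two hφ hc,
    zero_add]

end TestFunction

section TotalVariation

variable {φ g : ℝ → ℝ} {C : ℝ}

lemma IsUnitTestFunction.abs_le_one (hφ : IsUnitTestFunction φ) (t : ℝ) : |φ t| ≤ 1 := by
  obtain ⟨hsmooth, hc, hnorm⟩ := hφ
  have hbdd : BddAbove (range fun t => |φ t|) :=
    hsmooth.continuous.abs.bddAbove_range_of_hasCompactSupport hc.abs
  exact hnorm ▸ le_ciSup hbdd t

lemma isUnitTestFunction_inv_mul (hφ : ContDiff ℝ ∞ φ) (hc : HasCompactSupport φ)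
    (hpos : 0 < ⨆ t, |φ t|) : IsUnitTestFunction fun t => (⨆ s, |φ s|)⁻¹ * φ t := by
  refine ⟨contDiff_const.mul hφ, hc.mul_left, ?_⟩
  simp only [abs_mul, abs_of_pos (inv_pos.2 hpos)]
  rw [← Real.mul_iSup_of_nonneg (inv_nonneg.2 hpos.le), inv_mul_cancel₀ hpos.ne']

lemma integral_mul_iteratedDeriv_two_le (hg : TV2 g < ⊤) (hφ : ContDiff ℝ ∞ φ)
    (hc : HasCompactSupport φ) (hC : ∀ t, |φ t| ≤ C) :
    ∫ t, g t * iteratedDeriv 2 φ t ≤ C * (TV2 g).toReal := by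
  have hle : ∀ t, |φ t| ≤ ⨆ s, |φ s| := le_ciSup ⟨C, forall_mem_range.2 hC⟩
  rcases ((abs_nonneg _).trans (hle 0)).eq_or_lt with hzero | hpos
  · have hφ0 : φ = fun _ => 0 :=
      funext fun t => abs_nonpos_iff.1 ((hle t).trans_eq hzero.symm)
    simpa [hφ0, iteratedDeriv_const] using
      mul_nonneg ((abs_nonneg _).trans (hC 0)) ENNReal.toReal_nonneg
  · have hunit := (ENNReal.ofReal_le_iff_le_toReal hg.ne).1
      (le_iSup₂_of_le (f := fun ψ (_ : IsUnitTestFunction ψ) =>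
        ENNReal.ofReal (∫ t, g t * iteratedDeriv 2 ψ t))
        _ (isUnitTestFunction_inv_mul hφ hc hpos) le_rfl)
    simp only [iteratedDeriv_const_mul_field, mul_left_comm (g _), integral_const_mul] at hunit
    exact ((inv_mul_le_iff₀ hpos).1 hunit).trans
      (mul_le_mul_of_nonneg_right (ciSup_le hC) ENNReal.toReal_nonneg)

end TotalVariation

lemma Params.TV2_net_le (θ : Params) : TV2 θ.net ≤ ENNReal.ofReal (∑ k, |θ.v k| * |θ.w k|) := by
  refine iSup₂_le fun φ hφ => ENNReal.ofReal_le_ofReal ?_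
  rw [θ.integral_net_mul_iteratedDeriv_two (contDiff_infty.1 hφ.1 2) hφ.2.1,
    θ.linearCombination_curvature]
  refine Finset.sum_le_sum fun k _ => (le_abs_self _).trans ?_
  rw [abs_mul, abs_mul, abs_abs]
  exact mul_le_of_le_one_right (by positivity) (hφ.abs_le_one _)

lemma Params.net_mem_BV2 (θ : Params) : θ.net ∈ BV2 :=
  ⟨θ.continuous_net, θ.TV2_net_le.trans_lt ENNReal.ofReal_lt_top⟩

lemma Params.toReal_TV2_net_le_sum (θ : Params) :
    (TV2 θ.net).toReal ≤ ∑ k, |θ.v k| * |θ.w k| :=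
  ENNReal.toReal_le_of_le_ofReal (by positivity) θ.TV2_net_le

lemma Params.weightDecay_eq_sum_add_sum (θ : Params) :
    θ.weightDecay = ∑ k, |θ.v k| * |θ.w k| + ∑ k, (|θ.v k| - |θ.w k|) ^ 2 / 2 := by
  rw [weightDecay, ← Finset.sum_add_distrib]
  exact Finset.sum_congr rfl fun k _ => by ring

lemma Params.toReal_TV2_net_le_weightDecay (θ : Params) : (TV2 θ.net).toReal ≤ θ.weightDecay :=
  θ.toReal_TV2_net_le_sum.trans <|
    θ.weightDecay_eq_sum_add_sum ▸ le_add_of_nonneg_right (by positivity)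

lemma Params.abs_v_eq_abs_w {θ : Params} (h : θ.weightDecay ≤ (TV2 θ.net).toReal)
    (k : Fin θ.K) : |θ.v k| = |θ.w k| := by
  have hnonneg : ∀ j ∈ Finset.univ, 0 ≤ (|θ.v j| - |θ.w j|) ^ 2 / 2 := fun j _ => by positivity
  have hzero : ∑ j, (|θ.v j| - |θ.w j|) ^ 2 / 2 = 0 :=
    le_antisymm (by linarith [θ.weightDecay_eq_sum_add_sum, θ.toReal_TV2_net_le_sum])
      (Finset.sum_nonneg hnonneg)
  have hk := (Finset.sum_eq_zero_iff_of_nonneg hnonneg).1 hzero k (Finset.mem_univ k)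
  exact sub_eq_zero.1 (pow_eq_zero_iff two_ne_zero |>.1 (by linarith))

/-! ### Slope variation and total variation -/

section Duality

variable {g : ℝ → ℝ} {c : ℝ →₀ ℝ} {C : ℝ}

lemma iteratedDeriv_two_convolution_right {f ρ : ℝ → ℝ} (hf : LocallyIntegrable f)
    (hρ : ContDiff ℝ 2 ρ) (hc : HasCompactSupport ρ) :
    iteratedDeriv 2 (f ⋆ ρ) = f ⋆ iteratedDeriv 2 ρ := by
  have hderiv : deriv (f ⋆ ρ) = f ⋆ deriv ρ := funext fun t =>
    (hc.hasDerivAt_convolution_right _ hf (hρ.of_le one_le_two) t).deriv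
  have hderiv₂ : deriv (f ⋆ deriv ρ) = f ⋆ deriv (deriv ρ) := funext fun t =>
    (hc.deriv.hasDerivAt_convolution_right _ hf (hρ.deriv' (n := 1)) t).deriv
  simp only [iteratedDeriv_succ, iteratedDeriv_zero, hderiv, hderiv₂]

lemma iteratedDeriv_two_spline_convolution {ρ : ℝ → ℝ} (hρ : ContDiff ℝ 2 ρ)
    (hc : HasCompactSupport ρ) (c : ℝ →₀ ℝ) (t : ℝ) :
    iteratedDeriv 2 (spline c ⋆ ρ) t = Finsupp.linearCombination ℝ (fun a => ρ (t - a)) c := by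
  have hreflect : ContDiff ℝ 2 fun s => ρ (t - s) := hρ.comp (contDiff_const.sub contDiff_id)
  have hreflectc : HasCompactSupport fun s => ρ (t - s) :=
    hc.comp_homeomorph (Homeomorph.subLeft t)
  rw [iteratedDeriv_two_convolution_right (continuous_spline c).locallyIntegrable hρ hc,
    ← integral_spline_mul_iteratedDeriv_two hreflect hreflectc, iteratedDeriv_comp_const_sub,
    convolution_lsmul]
  simp

lemma abs_convolution_normed_le {f : ℝ → ℝ} (hf : ∀ t, |f t| ≤ C) (B : ContDiffBump (0 : ℝ))
    (t : ℝ) : |(f ⋆ B.normed volume) t| ≤ C := by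
  have hint : Integrable fun s => C * B.normed volume (t - s) :=
    (B.integrable_normed.comp_sub_left t).const_mul C
  have hbound (s : ℝ) : ‖f s • B.normed volume (t - s)‖ ≤ C * B.normed volume (t - s) := by
    rw [norm_smul, Real.norm_of_nonneg (B.nonneg_normed _)]
    exact mul_le_mul_of_nonneg_right (hf s) (B.nonneg_normed _)
  calc |(f ⋆ B.normed volume) t| ≤ ∫ s, C * B.normed volume (t - s) :=
        norm_integral_le_of_norm_le hint (ae_of_all _ hbound)
    _ = C := by rw [integral_const_mul, integral_sub_left_eq_self, B.integral_normed, mul_one]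

lemma linearCombination_normed_convolution_le (hg : g ∈ BV2) (hc : HasCompactSupport (spline c))
    (hC : ∀ t, |spline c t| ≤ C) (B : ContDiffBump (0 : ℝ)) :
    Finsupp.linearCombination ℝ (B.normed volume ⋆ g) c ≤ C * (TV2 g).toReal := by
  set ρ := B.normed volume
  have hρ : ContDiff ℝ ∞ ρ := B.contDiff_normed
  have hρc : HasCompactSupport ρ := B.hasCompactSupport_normed
  have hpair : ∫ t, g t * iteratedDeriv 2 (spline c ⋆ ρ) t =
      Finsupp.linearCombination ℝ (ρ ⋆ g) c := by
    have hint (a : ℝ) : Integrable fun t => c a * (ρ (t - a) * g t) :=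
      (((hρ.continuous.comp (continuous_sub_right a)).mul hg.1).integrable_of_hasCompactSupport
        (hρc.comp_homeomorph (Homeomorph.subRight a)).mul_right).const_mul _
    simp only [iteratedDeriv_two_spline_convolution (contDiff_infty.1 hρ 2) hρc,
      Finsupp.linearCombination_apply, Finsupp.sum, smul_eq_mul, mul_comm (g _), Finset.sum_mul,
      mul_assoc]
    rw [integral_finsetSum _ fun a _ => hint a]
    refine Finset.sum_congr rfl fun a _ => ?_
    rw [integral_const_mul, convolution_lsmul_swap]
    simp only [← neg_sub a, ρ, B.normed_neg, smul_eq_mul]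
  rw [← hpair]
  exact integral_mul_iteratedDeriv_two_le hg.2
    (hρc.contDiff_convolution_right _ (continuous_spline c).locallyIntegrable hρ)
    (hc.convolution _ hρc) (abs_convolution_normed_le hC B)

-- A compactly supported spline with second derivative `c` is a limit of test functions, so the
-- integral of `g` with respect to `c` obeys the bound that defines `TV2 g`.
lemma linearCombination_le_of_abs_spline_le (hg : g ∈ BV2) (hc : HasCompactSupport (spline c))
    (hC : ∀ t, |spline c t| ≤ C) : Finsupp.linearCombination ℝ g c ≤ C * (TV2 g).toReal := by
  obtain ⟨δ, -, hδ, hlim⟩ := exists_seq_strictAnti_tendsto (0 : ℝ)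
  let B (n : ℕ) : ContDiffBump (0 : ℝ) := ⟨δ n / 2, δ n, half_pos (hδ n), half_lt_self (hδ n)⟩
  have hB : Tendsto (fun n => Finsupp.linearCombination ℝ ((B n).normed volume ⋆ g) c) atTop
      (𝓝 (Finsupp.linearCombination ℝ g c)) := by
    simp only [Finsupp.linearCombination_apply, Finsupp.sum]
    exact tendsto_finsetSum _ fun a _ =>
      (ContDiffBump.convolution_tendsto_right_of_continuous hlim hg.1 a).const_smul _
  exact le_of_tendsto' hB fun n => linearCombination_normed_convolution_le hg hc hC (B n)

end Duality

/-- The discrete measure against which a function integrates to its slope between `a` and `b`. -/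
noncomputable def slopeMeasure (a b : ℝ) : ℝ →₀ ℝ :=
  (b - a)⁻¹ • (Finsupp.single b 1 - Finsupp.single a 1)

/-- The discrete measure against which a function `f` integrates to `slopeJump q f i`. The spline
with this second derivative is the hat function of height one over the knots `q i`, `q (i + 1)`
and `q (i + 2)`. -/
noncomputable def slopeJumpMeasure (q : ℕ → ℝ) (i : ℕ) : ℝ →₀ ℝ :=
  slopeMeasure (q (i + 1)) (q (i + 2)) - slopeMeasure (q i) (q (i + 1))

section Hat

variable {q : ℕ → ℝ} {i n : ℕ} {t : ℝ}

lemma linearCombination_slopeJumpMeasure (f : ℝ → ℝ) (q : ℕ → ℝ) (i : ℕ) :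
    Finsupp.linearCombination ℝ f (slopeJumpMeasure q i) = slopeJump q f i := by
  simp [slopeJumpMeasure, slopeMeasure, slopeJump, slope]

lemma slopeJump_relu_sub_nonneg (hq : StrictMono q) :
    0 ≤ slopeJump q (fun a => relu (t - a)) i := by
  rw [slopeJump, slope_def_field, slope_def_field, sub_nonneg]
  exact (convexOn_relu_sub t).slope_mono_adjacent (mem_univ _) (mem_univ _)
    (hq i.lt_succ_self) (hq (i + 1).lt_succ_self)

lemma slopeJump_relu_sub_eq_zero (hq : StrictMono q) (ht : t ∉ Icc (q i) (q (i + 2))) :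
    slopeJump q (fun a => relu (t - a)) i = 0 := by
  have hlt₁ : q i < q (i + 1) := hq i.lt_succ_self
  have hlt₂ : q (i + 1) < q (i + 2) := hq (i + 1).lt_succ_self
  rcases le_or_gt (q i) t with hle | hgt
  · have hgt : q (i + 2) < t := not_le.1 fun h => ht ⟨hle, h⟩
    have hslope {a b : ℝ} (hab : a < b) (hbt : b < t) :
        slope (fun a => relu (t - a)) a b = -1 := by
      rw [slope_def_field, relu_of_nonneg (by linarith), relu_of_nonneg (by linarith),
        div_eq_iff (sub_ne_zero.2 hab.ne')]
      ring
    rw [slopeJump, hslope hlt₁ (hlt₂.trans hgt), hslope hlt₂ hgt, sub_self]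
  · have hzero {a : ℝ} (ha : q i ≤ a) : relu (t - a) = 0 := relu_of_nonpos (by linarith)
    simp only [slopeJump, slope_def_field, hzero le_rfl, hzero hlt₁.le,
      hzero (hlt₁.trans hlt₂).le, sub_self, zero_div]

lemma sum_slopeJump_relu_sub_le_one (hq : StrictMono q) (n : ℕ) (t : ℝ) :
    ∑ i ∈ Finset.range n, slopeJump q (fun a => relu (t - a)) i ≤ 1 := by
  set h : ℝ → ℝ := fun a => relu (t - a)
  have hanti : Antitone h := monotone_relu.comp_antitone fun _ _ => (sub_le_sub_left · t)
  have hlast : slope h (q n) (q (n + 1)) ≤ 0 :=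
    (slope_nonpos_iff_of_le (hq n.lt_succ_self).le).2 (hanti (hq n.lt_succ_self).le)
  have hlip : LipschitzWith 1 h :=
    (lipschitzWith_one_relu.comp ((LipschitzWith.const t).sub LipschitzWith.id)).weaken (by simp)
  have hfirst : |slope h (q 0) (q 1)| ≤ 1 :=
    abs_slope_le_of_lipschitzWith hlip (hq zero_lt_one).ne
  calc ∑ i ∈ Finset.range n, slopeJump q h i
      = slope h (q n) (q (n + 1)) - slope h (q 0) (q 1) :=
        Finset.sum_range_sub (fun i => slope h (q i) (q (i + 1))) n
    _ ≤ 1 := by linarith [(abs_le.1 hfirst).1]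

lemma slopeVar_le_toReal_TV2 (hq : StrictMono q) {g : ℝ → ℝ} (hg : g ∈ BV2) (n : ℕ) :
    slopeVar q g n ≤ (TV2 g).toReal := by
  set c := ∑ i ∈ Finset.range n, (SignType.sign (slopeJump q g i) : ℝ) • slopeJumpMeasure q i
  have hc (f : ℝ → ℝ) : Finsupp.linearCombination ℝ f c =
      ∑ i ∈ Finset.range n, SignType.sign (slopeJump q g i) * slopeJump q f i := by
    simp only [c, map_sum, map_smul, linearCombination_slopeJumpMeasure, smul_eq_mul]
  have hsupport : HasCompactSupport (spline c) := by
    refine HasCompactSupport.intro (isCompact_Icc (a := q 0) (b := q (n + 1))) fun t ht => ?_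
    rw [spline, hc]
    refine Finset.sum_eq_zero fun i hi => mul_eq_zero_of_right _ ?_
    have hin : i + 2 ≤ n + 1 := by simpa using hi
    exact slopeJump_relu_sub_eq_zero hq fun h =>
      ht (Icc_subset_Icc (hq.monotone i.zero_le) (hq.monotone hin) h)
  have hbound (t : ℝ) : |spline c t| ≤ 1 := by
    rw [spline, hc]
    refine (Finset.abs_sum_le_sum_abs _ _).trans ((Finset.sum_le_sum fun i _ => ?_).trans
      (sum_slopeJump_relu_sub_le_one hq n t))
    rw [abs_mul, abs_of_nonneg (slopeJump_relu_sub_nonneg hq)]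
    refine mul_le_of_le_one_left (slopeJump_relu_sub_nonneg hq) ?_
    rcases lt_trichotomy (slopeJump q g i) 0 with h | h | h <;> simp [h]
  calc slopeVar q g n = Finsupp.linearCombination ℝ g c := by
        simp only [hc, slopeVar, sign_mul_self]
    _ ≤ 1 * (TV2 g).toReal := linearCombination_le_of_abs_spline_le hg hsupport hbound
    _ = (TV2 g).toReal := one_mul _

end Hat

lemma exists_net_eqOn {g : ℝ → ℝ} (hg : g ∈ BV2) {K : ℝ≥0} (hgK : LipschitzWith K g)
    (P : Finset ℝ) : ∃ η : Params,
      LipschitzWith K η.net ∧ EqOn η.net g P ∧ η.weightDecay ≤ (TV2 g).toReal := by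
  obtain ⟨q, hq, hqP⟩ := exists_strictMono_image_Iio_eq P
  refine ⟨brokenLineParams q g P.card, ?_, ?_, ?_⟩
  · rw [brokenLineParams_net]
    exact lipschitzWith_brokenLine hq hgK _
  · rw [brokenLineParams_net, ← hqP]
    rintro _ ⟨i, hi, rfl⟩
    exact brokenLine_knot hq (le_of_lt (Nat.lt_succ_of_lt hi))
  · rw [brokenLineParams_weightDecay]
    exact slopeVar_le_toReal_TV2 hq hg _

section Extrapolation

variable {q q' : ℕ → ℝ} {f : ℝ → ℝ} {n : ℕ} {t : ℝ}

lemma slopeJump_congr (h : EqOn q' q (Iio (n + 2))) {i : ℕ} (hi : i < n) :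
    slopeJump q' f i = slopeJump q f i := by
  rw [slopeJump, slopeJump, h (by grind : i ∈ Iio (n + 2)), h (by grind : i + 1 ∈ Iio (n + 2)),
    h (by grind : i + 2 ∈ Iio (n + 2))]

lemma slopeVar_congr (h : EqOn q' q (Iio (n + 2))) : slopeVar q' f n = slopeVar q f n :=
  Finset.sum_congr rfl fun i hi => by rw [slopeJump_congr h (Finset.mem_range.1 hi)]

lemma brokenLine_congr (h : EqOn q' q (Iio (n + 2))) :
    brokenLine q' f n t = brokenLine q f n t := by
  rw [brokenLine, brokenLine, h (by grind : 0 ∈ Iio (n + 2)), h (by grind : 1 ∈ Iio (n + 2))]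
  refine congrArg _ (Finset.sum_congr rfl fun i hi => ?_)
  have hin : i < n := Finset.mem_range.1 hi
  rw [slopeJump_congr h hin, h (by grind : i + 1 ∈ Iio (n + 2))]

lemma brokenLine_eq_of_gt (hq : StrictMono q) (hf : f ∈ BV2)
    (hTV : (TV2 f).toReal ≤ slopeVar q f n) (ht : q (n + 1) < t) : brokenLine q f n t = f t := by
  obtain ⟨q', hq', heq, rfl⟩ := exists_strictMono_eqOn_Iio (n := n + 2) hq fun i hi =>
    (hq.monotone (Nat.lt_succ_iff.1 hi)).trans_lt ht
  have hvar : slopeVar q' f (n + 1) = slopeVar q f n + |slopeJump q' f n| := by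
    rw [slopeVar, Finset.sum_range_succ, ← slopeVar, slopeVar_congr heq]
  have hjump : slopeJump q' f n = 0 :=
    abs_nonpos_iff.1 (by linarith [slopeVar_le_toReal_TV2 hq' hf (n + 1)])
  rw [← brokenLine_congr heq, ← brokenLine_knot (f := f) (n := n + 1) hq' le_rfl, brokenLine_succ,
    hjump, zero_mul, add_zero]

lemma brokenLine_eq_of_lt (hq : StrictMono q) (hf : f ∈ BV2)
    (hTV : (TV2 f).toReal ≤ slopeVar q f n) (ht : t < q 0) : brokenLine q f n t = f t := by
  have hvar : slopeVar (prepend t q) f (n + 1) = slopeVar q f n + |slopeJump (prepend t q) f 0| :=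
    Finset.sum_range_succ' _ _
  have hjump : slopeJump (prepend t q) f 0 = 0 := abs_nonpos_iff.1 <| by
    linarith [slopeVar_le_toReal_TV2 (strictMono_prepend hq ht) hf (n + 1)]
  have hslope : slope f (q 0) (q 1) = slope f t (q 0) := sub_eq_zero.1 hjump
  rw [brokenLine_of_le hq n.zero_le (ht.le.trans (hq.monotone zero_le_one)), brokenLine_zero,
    hslope]
  linear_combination -slope_mul_sub f t (q 0)

lemma disjoint_Ioo_succ_range (hq : StrictMono q) (i : ℕ) :
    Disjoint (Ioo (q i) (q (i + 1))) (range q) := by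
  rw [disjoint_left]
  rintro _ hj ⟨j, rfl⟩
  have hij := hq.lt_iff_lt.1 hj.1
  have hji := hq.lt_iff_lt.1 hj.2
  omega

lemma IsCPWL.exists_brokenLine_eqOn (hf : IsCPWL f) (P : Finset ℝ) :
    ∃ (q : ℕ → ℝ) (n : ℕ), StrictMono q ∧ ↑P ⊆ q '' Iio (n + 2) ∧
      EqOn (brokenLine q f n) f (Icc (q 0) (q (n + 1))) := by
  obtain ⟨S, hS, hcont, haff⟩ := hf
  obtain ⟨r, hr, hPr⟩ := P.finite_toSet.isBounded.subset_closedBall_lt 0 0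
  rw [Real.closedBall_eq_Icc, zero_sub, zero_add] at hPr
  let Q : Finset ℝ := {-r, r} ∪ (P ∪ (hS (-r) r).toFinset)
  have hQr : (Q : Set ℝ) ⊆ Icc (-r) r := by
    simp only [Q, Finset.coe_union, Finset.coe_pair, Finite.coe_toFinset]
    exact union_subset (pair_subset ⟨le_rfl, by linarith⟩ ⟨by linarith, le_rfl⟩)
      (union_subset hPr inter_subset_right)
  have hcard : 1 < Q.card :=
    Finset.one_lt_card.2 ⟨-r, by simp [Q], r, by simp [Q], by linarith⟩
  obtain ⟨n, hn⟩ : ∃ n, Q.card = n + 2 := Nat.exists_eq_add_of_le' hcard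
  obtain ⟨q, hq, hqQ⟩ := exists_strictMono_image_Iio_eq Q
  rw [hn] at hqQ
  have hqr (i : ℕ) (hi : i < n + 2) : q i ∈ Icc (-r) r := hQr (hqQ ▸ mem_image_of_mem q hi)
  have hPq : ↑P ⊆ q '' Iio (n + 2) := by
    rw [hqQ]
    exact fun t ht => by simp [Q, Finset.mem_coe.1 ht]
  refine ⟨q, n, hq, hPq, eqOn_brokenLine_of_affine hq hcont fun i hi => ?_⟩
  refine haff _ _ (hq i.lt_succ_self) (disjoint_left.2 fun s hs hsS => ?_)
  have hsr : s ∈ Icc (-r) r :=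
    ⟨(hqr i (by omega)).1.trans hs.1.le, hs.2.le.trans (hqr (i + 1) (by omega)).2⟩
  have hsQ : s ∈ q '' Iio (n + 2) := by
    rw [hqQ]
    simp [Q, hsS, hsr.1, hsr.2]
  exact disjoint_left.1 (disjoint_Ioo_succ_range hq i) hs (image_subset_range _ _ hsQ)

end Extrapolation

/-! ### Solutions of the two problems -/

section Optimality

variable {M : ℕ} {E : ℝ → ℝ → ℝ} {x y : Fin M → ℝ} {lam : ℝ} {K : ℝ≥0} {f : ℝ → ℝ} {θ η : Params}

lemma toReal_TV2_le_weightDecay_of_mem_Vhyb (hlam : 0 < lam) (hf : f ∈ Vhyb E x y lam K)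
    (hη : LipschitzWith K η.net) (hfit : ∀ m, η.net (x m) = f (x m)) :
    (TV2 f).toReal ≤ η.weightDecay := by
  have hmin := hf.2 η.net η.net_mem_BV2 (lipConst_le_iff_lipschitzWith.2 hη)
  simp only [hfit] at hmin
  exact (le_of_mul_le_mul_left (le_of_add_le_add_left hmin) hlam).trans
    η.toReal_TV2_net_le_weightDecay

lemma weightDecay_le_of_mem_VNN (hlam : 0 < lam) (hθ : θ ∈ VNN E x y lam K)
    (hη : LipschitzWith K η.net) (hfit : ∀ m, η.net (x m) = θ.net (x m)) :
    θ.weightDecay ≤ η.weightDecay := by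
  have hmin := hθ.2 η (lipConst_le_iff_lipschitzWith.2 hη)
  simp only [hfit] at hmin
  exact le_of_mul_le_mul_left (le_of_add_le_add_left hmin) hlam

lemma exists_net_eq_on_data {g : ℝ → ℝ} (hg : g ∈ BV2) (hgK : LipschitzWith K g)
    (x : Fin M → ℝ) : ∃ η : Params, LipschitzWith K η.net ∧ (∀ m, η.net (x m) = g (x m)) ∧
      η.weightDecay ≤ (TV2 g).toReal := by
  obtain ⟨η, hη, hfit, hdecay⟩ := exists_net_eqOn hg hgK (Finset.univ.image x)
  exact ⟨η, hη, fun m => hfit (by simp), hdecay⟩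

lemma net_mem_Vhyb (hlam : 0 ≤ lam) (hθ : θ ∈ VNN E x y lam K) : θ.net ∈ Vhyb E x y lam K := by
  refine ⟨⟨θ.net_mem_BV2, hθ.1⟩, fun g hg hgK => ?_⟩
  obtain ⟨η, hη, hfit, hdecay⟩ :=
    exists_net_eq_on_data hg (lipConst_le_iff_lipschitzWith.1 hgK) x
  calc ∑ m, E (θ.net (x m)) (y m) + lam * (TV2 θ.net).toReal
      ≤ ∑ m, E (θ.net (x m)) (y m) + lam * θ.weightDecay := by
        gcongr
        exact θ.toReal_TV2_net_le_weightDecay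
    _ ≤ ∑ m, E (η.net (x m)) (y m) + lam * η.weightDecay :=
        hθ.2 η (lipConst_le_iff_lipschitzWith.2 hη)
    _ ≤ ∑ m, E (g (x m)) (y m) + lam * (TV2 g).toReal := by
        simp only [hfit]
        gcongr

lemma abs_v_eq_abs_w_of_mem_VNN (hlam : 0 < lam) (hθ : θ ∈ VNN E x y lam K) (k : Fin θ.K) :
    |θ.v k| = |θ.w k| := by
  obtain ⟨η, hη, hfit, hdecay⟩ :=
    exists_net_eq_on_data θ.net_mem_BV2 (lipConst_le_iff_lipschitzWith.1 hθ.1) x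
  exact θ.abs_v_eq_abs_w ((weightDecay_le_of_mem_VNN hlam hθ hη hfit).trans hdecay) k

lemma exists_brokenLine_eq_of_mem_Vhyb (hlam : 0 < lam) (hf : f ∈ Vhyb E x y lam K)
    (hpl : IsCPWL f) : ∃ (q : ℕ → ℝ) (n : ℕ), StrictMono q ∧ brokenLine q f n = f := by
  obtain ⟨q, n, hq, hdata, heq⟩ := hpl.exists_brokenLine_eqOn (Finset.univ.image x)
  have hTV : (TV2 f).toReal ≤ slopeVar q f n := by
    rw [← brokenLineParams_weightDecay]
    refine toReal_TV2_le_weightDecay_of_mem_Vhyb hlam hf ?_ fun m => ?_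
    · rw [brokenLineParams_net]
      exact lipschitzWith_brokenLine hq (lipConst_le_iff_lipschitzWith.1 hf.1.2) n
    · obtain ⟨i, hi, hxm⟩ := hdata (show x m ∈ _ by simp)
      rw [← hxm, brokenLineParams_net, brokenLine_knot hq (Nat.lt_succ_iff.1 hi)]
  refine ⟨q, n, hq, funext fun t => ?_⟩
  rcases lt_or_ge t (q 0) with hlt | hge
  · exact brokenLine_eq_of_lt hq hf.1.1 hTV hlt
  rcases lt_or_ge (q (n + 1)) t with hgt | hle
  · exact brokenLine_eq_of_gt hq hf.1.1 hTV hgt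
  · exact heq ⟨hge, hle⟩

lemma exists_mem_VNN_net_eq (hlam : 0 < lam) (hf : f ∈ Vhyb E x y lam K) (hpl : IsCPWL f) :
    ∃ θ ∈ VNN E x y lam K, θ.net = f := by
  obtain ⟨q, n, hq, heq⟩ := exists_brokenLine_eq_of_mem_Vhyb hlam hf hpl
  have hnet : (brokenLineParams q f n).net = f := (brokenLineParams_net q f n).trans heq
  refine ⟨brokenLineParams q f n, ⟨by rw [hnet]; exact hf.1.2, fun η hη => ?_⟩, hnet⟩
  rw [hnet, brokenLineParams_weightDecay]
  calc ∑ m, E (f (x m)) (y m) + lam * slopeVar q f n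
      ≤ ∑ m, E (f (x m)) (y m) + lam * (TV2 f).toReal := by
        gcongr
        exact slopeVar_le_toReal_TV2 hq hf.1.1 n
    _ ≤ ∑ m, E (η.net (x m)) (y m) + lam * (TV2 η.net).toReal := hf.2 η.net η.net_mem_BV2 hη
    _ ≤ ∑ m, E (η.net (x m)) (y m) + lam * η.weightDecay := by
        gcongr
        exact η.toReal_TV2_net_le_weightDecay

end Optimality

end LipReLU

theorem proposition1_general (M : ℕ) (x y : Fin M → ℝ) (E : ℝ → ℝ → ℝ) (lam : ℝ) (Lbar : NNReal)
    (hlam : 0 < lam) :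
    (∀ θ ∈ LipReLU.VNN E x y lam Lbar,
      θ.net ∈ LipReLU.Vhyb E x y lam Lbar ∧ LipReLU.IsFiniteCPWL θ.net ∧
        ∀ k, |θ.v k| = |θ.w k|) ∧
    (∀ f ∈ LipReLU.Vhyb E x y lam Lbar, LipReLU.IsCPWL f →
      ∃ θ ∈ LipReLU.VNN E x y lam Lbar, θ.net = f) :=
  ⟨fun θ hθ => ⟨LipReLU.net_mem_Vhyb hlam.le hθ, θ.isFiniteCPWL_net,
      LipReLU.abs_v_eq_abs_w_of_mem_VNN hlam hθ⟩,
    fun _ => LipReLU.exists_mem_VNN_net_eq hlam⟩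

theorem proposition1 (M : ℕ) (x y : Fin M → ℝ) (hx : StrictMono x)
    (E : ℝ → ℝ → ℝ)
    (hE_convex : ∀ s : ℝ, StrictConvexOn ℝ Set.univ (fun z : ℝ => E z s))
    (hE_coercive : ∀ s : ℝ,
      Filter.Tendsto (fun z : ℝ => E z s) (Filter.cocompact ℝ) Filter.atTop)
    (lam Lbar : ℝ) (hlam : 0 < lam) (hLbar : 0 < Lbar) :
    (∀ θ ∈ LipReLU.VNN E x y lam Lbar,
      θ.net ∈ LipReLU.Vhyb E x y lam Lbar ∧ LipReLU.IsFiniteCPWL θ.net ∧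
        ∀ k, |θ.v k| = |θ.w k|) ∧
    (∀ f ∈ LipReLU.Vhyb E x y lam Lbar, LipReLU.IsCPWL f →
      ∃ θ ∈ LipReLU.VNN E x y lam Lbar, θ.net = f) :=
  proposition1_general M x y E lam ⟨Lbar, hLbar.le⟩ hlam
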